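/- **Model.** There are $J$ agents; agent $j$ has finite sets $S^j,A^j,O^j$ of local states, actions and observations and a finite non-empty set $\Omega^j$ of options. Let $\mathcal S=\prod_j S^j$, $\mathcal A=\prod_j A^j$, $\mathcal O=\prod_j O^j$, $\Omega=\prod_j\Omega^j$. The data are: transition probabilities $p^{\mathbf a}(\mathbf s,\mathbf s')$; a map $\kappa:\mathcal A\to K$ to a finite set $K$ and observation probabilities $\eta(\mathbf o\mid\mathbf s,k)$, $k\in K$; for each option $\omega^j$ an action-policy $\pi^{\omega^j}(a^j\mid o^j)$, a broadcast-policy $\pi^{b,\omega^j}(\mathrm{br}^j\mid o^j)$ with $\mathrm{br}^j\in\{0,1\}$, and a termination probability $\beta^{\omega^j}(s^j)\in(0,1]$ (which plays no role below, because a joint-option is drawn at every stage); a per-step reward $R(\mathbf s,\mathbf a,\mathbf{br},\mathbf s')\in\mathbb R$; a discount factor $\gamma\in(0,1)$. (For $K=\mathcal A$, $\kappa=\mathrm{id}$, observations may depend arbitrarily on the previous joint-action; for $K$ a single point they depend on the current joint-state only.) At stage $t=0,1,2,\dots$ a coordinator draws a joint-option $\boldsymbol\omega_t\in\Omega$ from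 a distribution that may depend on the common information $I^c_t=(\boldsymbol\omega_i,\tilde{\mathbf o}_i)_{i<t}$, and announces it. Then $\mathbf o_t\sim\eta(\cdot\mid\mathbf s_t,k_t)$, where $k_t=\kappa(\mathbf a_{t-1})$ for $t\ge1$; given $\mathbf o_t$, independently over $j$ and of each other, $\mathrm{br}^j_t\sim\pi^{b,\omega^j_t}(\cdot\mid o^j_t)$ and $a^j_t\sim\pi^{\omega^j_t}(\cdot\mid o^j_t)$; the common observation $\tilde{\mathbf o}_t\in\prod_j(O^j\cup\{\varnothing\})$ has $\tilde o^j_t=o^j_t$ if $\mathrm{br}^j_t=1$ and $\tilde o^j_t=\varnothing$ otherwise; and $\mathbf s_{t+1}\sim p^{\mathbf a_t}(\mathbf s_t,\cdot)$. For a coordination strategy $\psi$ and $(\mathbf s_0,k_0)\sim b\in\Delta(\mathcal S\times K)$ let $V^\psi(b)=\sum_{t\ge0}\gamma^t\,\mathbb E^\psi_b[R(\mathbf s_t,\mathbf a_t,\mathbf{br}_t,\mathbf s_{t+1})]$, and let $V^*(b)=\sup_\psi V^\psi(b)$ over all (history-dependent, randomised) coordination strategies. For a belief $b\in\Delta(\mathcal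 S\times K)$ let $r^{\boldsymbol\omega}(b)$ be the expected one-stage reward, $\mathbb P(\tilde{\mathbf o}\mid b,\boldsymbol\omega)$ the probability of the common observation $\tilde{\mathbf o}$, and $b'_{b,\boldsymbol\omega,\tilde{\mathbf o}}$ the conditional distribution of (next joint-state, label $\kappa$ of the current joint-action) given $\tilde{\mathbf o}$, when the current pair (joint-state, label) has distribution $b$ and the joint-option is $\boldsymbol\omega$ (if $\mathbb P(\tilde{\mathbf o}\mid b,\boldsymbol\omega)=0$ its value is immaterial). The common belief $b^c_t$ is obtained from $b^c_0=b$ by $b^c_{t+1}=b'_{b^c_t,\boldsymbol\omega_t,\tilde{\mathbf o}_t}$. A Markov joint-option policy is a sequence $\mu=(\mu_t)_t$ of maps from beliefs to $\Delta(\Omega)$, used as $\boldsymbol\omega_t\sim\mu_t(\cdot\mid b^c_t)$; it is time-homogeneous if $\mu_t$ does not depend on $t$. Write $V^\mu(b)$ for its value from $b$. **Theorem.** All series defining $V^\psi(b)$ converge. For every strategy and every common information $I^c_t$ of positive probability, $b^c_t(\mathbf s,k)=\mathbb P(\mathbf s_t=\mathbf s,\,k_t=k\mid I^c_t)$. Moreover: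 1. $V^*(b)$ is finite for all $b$, $V^*$ is bounded, and $V^*$ is the unique bounded function of $b$ with $$V(b)=\max_{\mu}\sum_{\boldsymbol\omega\in\Omega}\mu(\boldsymbol\omega\mid b)\Big[r^{\boldsymbol\omega}(b)+\gamma\sum_{\tilde{\mathbf o}}\mathbb P(\tilde{\mathbf o}\mid b,\boldsymbol\omega)\,V\big(b'_{b,\boldsymbol\omega,\tilde{\mathbf o}}\big)\Big]\quad\text{for all }b,$$ where $\mu$ ranges over the maps from beliefs to $\Delta(\Omega)$ and the maximum is attained. 2. For every time-homogeneous Markov joint-option policy $\mu$, $V^\mu$ is the unique bounded solution of $V(b)=\sum_{\boldsymbol\omega}\mu(\boldsymbol\omega\mid b)\big[r^{\boldsymbol\omega}(b)+\gamma\sum_{\tilde{\mathbf o}}\mathbb P(\tilde{\mathbf o}\mid b,\boldsymbol\omega)V(b'_{b,\boldsymbol\omega,\tilde{\mathbf o}})\big]$. There is a time-homogeneous Markov joint-option policy $\mu^*$, depending only on the common belief, such that for all $b$: $V^{\mu^*}(b)=V^*(b)$, and $V^{\mu^*}(b)$ is the maximum of the values from $b$ of all Markov joint-option policies and of all coordination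 strategies. -/

import Mathlib

/-- An option of a single agent with local states `S`, local observations `O` and local actions
`A`: an action-policy, a broadcast-policy (`true` = broadcast) and a termination probability in
`(0, 1]`.  The coordinator draws a fresh joint-option at every stage, so the termination
probability does not enter the coordinator's problem. -/
structure LocalOption (S O A : Type*) [Fintype A] where
  act : O → stdSimplex ℝ A
  bcast : O → stdSimplex ℝ Bool
  term : S → Set.Ioc (0 : ℝ) 1

/-- A `J`-agent Dec-POMDP with options and broadcasting.
`S j`, `A j`, `O j`, `Ω j` are the local states, actions, observations and options of agent `j`.

The joint-observation at a stage is drawn from a kernel that may depend on the current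
joint-state and on the previous joint-action, the latter through its label in `K`:
`K` the set of joint-actions and `label = id` is an arbitrary dependence on the previous
joint-action, `K` a one-point set is no dependence on it. -/
structure DecPOMDP (J : ℕ) (S A O Ω : Fin J → Type*) (K : Type*)
    [∀ j, Fintype (S j)] [∀ j, Fintype (A j)] [∀ j, Fintype (O j)] where
  /-- `trans a s s'` is the probability of moving from `s` to `s'` under `a`. -/
  trans : (∀ j, A j) → (∀ j, S j) → stdSimplex ℝ (∀ j, S j)
  label : (∀ j, A j) → K
  /-- `obs s k o` is the probability of the joint-observation `o` in the joint-state `s`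
  when the previous joint-action has label `k`. -/
  obs : (∀ j, S j) → K → stdSimplex ℝ (∀ j, O j)
  opt : ∀ j, Ω j → LocalOption (S j) (O j) (A j)
  /-- per-step reward: joint-state, joint-action, broadcast symbols, next joint-state -/
  reward : (∀ j, S j) → (∀ j, A j) → (Fin J → Bool) → (∀ j, S j) → ℝ
  discount : ℝ
  discount_pos : 0 < discount
  discount_lt_one : discount < 1

set_option linter.unusedSectionVars false

noncomputable section

namespace DecPOMDP

section Model

variable {J : ℕ} {S A O Ω : Fin J → Type*} {K : Type*}
  [∀ j, Fintype (S j)] [∀ j, Fintype (A j)] [∀ j, Fintype (O j)] [∀ j, Fintype (Ω j)] [Fintype K]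

/-- The joint action-policy of the joint-option `ω`. -/
def jointAct (M : DecPOMDP J S A O Ω K) (ω : ∀ j, Ω j) (o : ∀ j, O j) (a : ∀ j, A j) : ℝ :=
  ∏ j, (M.opt j (ω j)).act (o j) (a j)

/-- The joint broadcast-policy of the joint-option `ω`. -/
def jointBcast (M : DecPOMDP J S A O Ω K) (ω : ∀ j, Ω j) (o : ∀ j, O j) (br : Fin J → Bool) : ℝ :=
  ∏ j, (M.opt j (ω j)).bcast (o j) (br j)

/-- The common observation: the observation of each agent that broadcasts, and `none` for the
others. -/
def commonObs (o : ∀ j, O j) (br : Fin J → Bool) : ∀ j, Option (O j) :=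
  fun j => if br j then some (o j) else none

/-- Common beliefs: distributions of the current joint-state and the label of the previous
joint-action. -/
abbrev Belief (_M : DecPOMDP J S A O Ω K) := stdSimplex ℝ ((∀ j, S j) × K)

/-- Probability of the joint-observation `o`, the broadcast symbols `br` and the joint-action `a`,
given the joint-state `s`, the previous label `k` and the joint-option `ω`. -/
def emitProb (M : DecPOMDP J S A O Ω K) (ω : ∀ j, Ω j) (s : ∀ j, S j) (k : K)
    (o : ∀ j, O j) (br : Fin J → Bool) (a : ∀ j, A j) : ℝ :=
  M.obs s k o * M.jointBcast ω o br * M.jointAct ω o a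

/-- Expected immediate reward of `a` and `br` in the joint-state `s`. -/
def immReward (M : DecPOMDP J S A O Ω K) (a : ∀ j, A j) (br : Fin J → Bool) (s : ∀ j, S j) : ℝ :=
  ∑ s', M.trans a s s' * M.reward s a br s'

/-- Expected one-step reward of the joint-option `ω` at the joint-state `s` and label `k`. -/
def stateReward (M : DecPOMDP J S A O Ω K) (ω : ∀ j, Ω j) (s : ∀ j, S j) (k : K) : ℝ :=
  ∑ o, ∑ br, ∑ a, M.emitProb ω s k o br a * M.immReward a br s

/-- Expected one-step reward of the joint-option `ω` at the common belief `b`. -/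
def optionReward (M : DecPOMDP J S A O Ω K) (ω : ∀ j, Ω j) (b : M.Belief) : ℝ :=
  ∑ s, ∑ k, b (s, k) * M.stateReward ω s k

open Classical in
/-- Probability that the common observation is `y`, the next joint-state is `s'` and the label of
the current joint-action is `k'`, given `s`, `k` and the joint-option `ω`. -/
def stepProb (M : DecPOMDP J S A O Ω K) (ω : ∀ j, Ω j) (s : ∀ j, S j) (k : K)
    (y : ∀ j, Option (O j)) (s' : ∀ j, S j) (k' : K) : ℝ :=
  ∑ o, ∑ br, ∑ a,
    if commonObs o br = y ∧ M.label a = k' then M.emitProb ω s k o br a * M.trans a s s' else 0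

open Classical in
/-- Probability of the common observation `y` given the common belief `b` and the
joint-option `ω`. -/
def obsProb (M : DecPOMDP J S A O Ω K) (b : M.Belief) (ω : ∀ j, Ω j)
    (y : ∀ j, Option (O j)) : ℝ :=
  ∑ s, ∑ k, ∑ o, ∑ br, ∑ a, if commonObs o br = y then b (s, k) * M.emitProb ω s k o br a else 0

/-- Unnormalised next belief. -/
def nextWeight (M : DecPOMDP J S A O Ω K) (b : M.Belief) (ω : ∀ j, Ω j)
    (y : ∀ j, Option (O j)) (s' : ∀ j, S j) (k' : K) : ℝ :=
  ∑ s, ∑ k, b (s, k) * M.stepProb ω s k y s' k'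

theorem emitProb_nonneg (M : DecPOMDP J S A O Ω K) (ω : ∀ j, Ω j) (s : ∀ j, S j) (k : K)
    (o : ∀ j, O j) (br : Fin J → Bool) (a : ∀ j, A j) : 0 ≤ M.emitProb ω s k o br a :=
  mul_nonneg (mul_nonneg ((M.obs s k).2.1 o)
    (Finset.prod_nonneg fun j _ => ((M.opt j (ω j)).bcast (o j)).2.1 (br j)))
    (Finset.prod_nonneg fun j _ => ((M.opt j (ω j)).act (o j)).2.1 (a j))

theorem nextWeight_nonneg (M : DecPOMDP J S A O Ω K) (b : M.Belief) (ω : ∀ j, Ω j)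
    (y : ∀ j, Option (O j)) (s' : ∀ j, S j) (k' : K) : 0 ≤ M.nextWeight b ω y s' k' := by
  refine Finset.sum_nonneg fun s _ => Finset.sum_nonneg fun k _ => mul_nonneg (b.2.1 _) ?_
  refine Finset.sum_nonneg fun o _ => Finset.sum_nonneg fun br _ => Finset.sum_nonneg fun a _ => ?_
  split_ifs
  · exact mul_nonneg (M.emitProb_nonneg ω s k o br a) ((M.trans a s).2.1 s')
  · exact le_rfl

theorem sum_nextWeight (M : DecPOMDP J S A O Ω K) (b : M.Belief) (ω : ∀ j, Ω j)
    (y : ∀ j, Option (O j)) : ∑ x : (∀ j, S j) × K, M.nextWeight b ω y x.1 x.2 =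
      M.obsProb b ω y := by
  unfold nextWeight stepProb obsProb
  rw [Finset.sum_comm]
  refine Finset.sum_congr rfl fun s _ => ?_
  rw [Finset.sum_comm]
  refine Finset.sum_congr rfl fun k _ => ?_
  rw [← Finset.mul_sum, Finset.sum_comm, Finset.mul_sum]
  refine Finset.sum_congr rfl fun o _ => ?_
  rw [Finset.sum_comm, Finset.mul_sum]
  refine Finset.sum_congr rfl fun br _ => ?_
  rw [Finset.sum_comm, Finset.mul_sum]
  refine Finset.sum_congr rfl fun a _ => ?_
  have ht : ∑ s', M.trans a s s' = 1 := (M.trans a s).2.2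
  rw [Fintype.sum_prod_type]
  by_cases hc : commonObs o br = y
  · rw [if_pos hc]
    refine congrArg (b (s, k) * ·) ((Finset.sum_congr rfl fun s' _ =>
      Finset.sum_eq_single (M.label a) (fun k' _ hk => if_neg fun h => hk h.2.symm)
        fun h => absurd (Finset.mem_univ _) h).trans ?_)
    refine (Finset.sum_congr rfl fun s' _ => if_pos ⟨hc, rfl⟩).trans ?_
    rw [← Finset.mul_sum, ht, mul_one]
  · simp [hc]

open Classical in
/-- The common belief at the next stage, by Bayes' rule, after the joint-option `ω` was announced
and the common observation `y` was received.  If `y` has probability zero, the value is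
irrelevant (it is set to `b`). -/
def nextBelief (M : DecPOMDP J S A O Ω K) (b : M.Belief) (ω : ∀ j, Ω j)
    (y : ∀ j, Option (O j)) : M.Belief :=
  if h : M.obsProb b ω y = 0 then b
  else ⟨fun x => M.nextWeight b ω y x.1 x.2 / M.obsProb b ω y,
    fun x => div_nonneg (M.nextWeight_nonneg b ω y x.1 x.2)
      (M.sum_nextWeight b ω y ▸ Finset.sum_nonneg fun x _ => M.nextWeight_nonneg b ω y x.1 x.2),
    by rw [← Finset.sum_div, sum_nextWeight, div_self h]⟩

/-- The common information after `t` stages: the announced joint-options and the common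
observations. -/
abbrev History (_M : DecPOMDP J S A O Ω K) (t : ℕ) := Fin t → (∀ j, Ω j) × (∀ j, Option (O j))

/-- The coordinator's (history-dependent, randomised) coordination strategies. -/
abbrev Strategy (M : DecPOMDP J S A O Ω K) := ∀ t, M.History t → stdSimplex ℝ (∀ j, Ω j)

/-- Joint-option policies that depend on the common belief only. -/
abbrev Policy (M : DecPOMDP J S A O Ω K) := M.Belief → stdSimplex ℝ (∀ j, Ω j)

/-- `M.law ψ b t h s k` is the probability that, when the initial joint-state and label are drawn
from `b` and the coordinator uses `ψ`, the common information after `t` stages is `h`, the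
joint-state is then `s` and the label of the last joint-action is `k`. -/
def law (M : DecPOMDP J S A O Ω K) (ψ : M.Strategy) (b : M.Belief) :
    (t : ℕ) → M.History t → (∀ j, S j) → K → ℝ
  | 0, _, s, k => b (s, k)
  | t + 1, h, s', k' =>
      ∑ s, ∑ k, law M ψ b t (Fin.init h) s k * ψ t (Fin.init h) (h (Fin.last t)).1 *
        M.stepProb (h (Fin.last t)).1 s k (h (Fin.last t)).2 s' k'

/-- Expected reward at stage `t` under the strategy `ψ` from the initial belief `b`. -/
def expReward (M : DecPOMDP J S A O Ω K) (ψ : M.Strategy) (b : M.Belief) (t : ℕ) : ℝ :=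
  ∑ h : M.History t, ∑ s, ∑ k, ∑ ω, M.law ψ b t h s k * ψ t h ω * M.stateReward ω s k

/-- Expected infinite-horizon discounted reward. -/
def value (M : DecPOMDP J S A O Ω K) (ψ : M.Strategy) (b : M.Belief) : ℝ :=
  ∑' t, M.discount ^ t * M.expReward ψ b t

/-- The optimal value: supremum over all coordination strategies. -/
def optValue (M : DecPOMDP J S A O Ω K) (b : M.Belief) : ℝ :=
  ⨆ ψ : M.Strategy, M.value ψ b

/-- The common belief after the common information `h`, starting from `b`, computed by the
Bayesian filter. -/
def commonBelief (M : DecPOMDP J S A O Ω K) (b : M.Belief) : (t : ℕ) → M.History t → M.Belief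
  | 0, _ => b
  | t + 1, h => M.nextBelief (commonBelief M b t (Fin.init h))
      (h (Fin.last t)).1 (h (Fin.last t)).2

/-- The Markov strategy that uses at stage `t` the policy `μ t` at the current common belief;
it is time-homogeneous if `μ` is constant. -/
def markov (M : DecPOMDP J S A O Ω K) (μ : ℕ → M.Policy) (b : M.Belief) : M.Strategy :=
  fun t h => μ t (M.commonBelief b t h)

/-- Value of a Markov joint-option policy as a function of the initial common belief. -/
def markovValue (M : DecPOMDP J S A O Ω K) (μ : ℕ → M.Policy) (b : M.Belief) : ℝ :=
  M.value (M.markov μ b) b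

/-- The one-step operator of the policy `μ` applied to `V`, at the common belief `b`. -/
def bellman (M : DecPOMDP J S A O Ω K) (μ : M.Policy) (V : M.Belief → ℝ) (b : M.Belief) : ℝ :=
  ∑ ω, μ b ω * (M.optionReward ω b +
    M.discount * ∑ y, M.obsProb b ω y * V (M.nextBelief b ω y))

/-- `V` solves the dynamic program: at every common belief, `V` is the maximum of the one-step
operators over all joint-option policies. -/
def SolvesDP (M : DecPOMDP J S A O Ω K) (V : M.Belief → ℝ) : Prop :=
  ∀ b, IsGreatest (Set.range fun μ : M.Policy => M.bellman μ V b) (V b)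

end Model

end DecPOMDP

end

/-! ### Discounted fixed points and averages over a simplex. -/

open Filter Topology

/-! The common belief is a sufficient statistic. The joint law of common information, joint-state
and label factors as the probability of the information times the filtered belief
(`law_eq_histProb_mul`), so every expected reward is an average over histories of a function of
belief and joint-option only. The coordinator thus faces a discounted decision process on beliefs
with finitely many actions.

For bounded `V`, the reward of the first `n` stages plus the discounted expectation of `V` at the
belief of stage `n` converges to the value of the strategy. If no joint-option improves on `V` in
one step, these quantities never exceed `V b`; if `V` solves the evaluation equation of a policy,
they all equal `V b` under it. Blackwell's theorem supplies bounded solutions of the optimality and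
evaluation equations. Identifying each bounded solution with a value also gives uniqueness, and
choosing a maximiser at each belief gives the optimal policy. -/

/-- Blackwell's fixed-point theorem: an operator on real functions that is monotone up to a
discounted constant and maps `0` to a bounded function has a bounded fixed point. -/
theorem exists_bounded_fixedPoint {X : Type*} (T : (X → ℝ) → X → ℝ) {γ R : ℝ} (hγ₀ : 0 ≤ γ)
    (hγ₁ : γ < 1)
    (hT : ∀ V W : X → ℝ, ∀ c, 0 ≤ c → (∀ x, V x ≤ W x + c) → ∀ x, T V x ≤ T W x + γ * c)
    (h0 : ∀ x, |T 0 x| ≤ R) : ∃ V : X → ℝ, (∃ C, ∀ x, |V x| ≤ C) ∧ ∀ x, V x = T V x := by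
  -- In the discrete topology every bounded function is continuous, so bounded continuous functions
  -- form the complete space of all bounded functions.
  let _ : TopologicalSpace X := ⊥
  have : DiscreteTopology X := ⟨rfl⟩
  have habs : ∀ V W : X → ℝ, ∀ c, 0 ≤ c → (∀ x, |V x - W x| ≤ c) →
      ∀ x, |T V x - T W x| ≤ γ * c := by
    intro V W c hc h x
    have h1 := hT V W c hc (fun y => by linarith [(abs_le.1 (h y)).2]) x
    have h2 := hT W V c hc (fun y => by linarith [(abs_le.1 (h y)).1]) x
    exact abs_le.2 ⟨by linarith, by linarith⟩
  have hbd : ∀ V : BoundedContinuousFunction X ℝ, ∀ x, ‖T V x‖ ≤ γ * ‖V‖ + R := by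
    intro V x
    have h1 := habs V 0 ‖V‖ (norm_nonneg V) (fun y => by simpa using V.norm_coe_le_norm y) x
    have h2 := h0 x
    have h3 := abs_add_le (T V x - T 0 x) (T 0 x)
    rw [sub_add_cancel] at h3
    rw [Real.norm_eq_abs]
    linarith
  let F : BoundedContinuousFunction X ℝ → BoundedContinuousFunction X ℝ := fun V =>
    BoundedContinuousFunction.ofNormedAddCommGroup (T V) continuous_of_discreteTopology _ (hbd V)
  have hF : ContractingWith ⟨γ, hγ₀⟩ F := by
    refine ⟨by exact_mod_cast hγ₁, LipschitzWith.of_dist_le_mul fun V W => ?_⟩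
    refine (BoundedContinuousFunction.dist_le (mul_nonneg hγ₀ dist_nonneg)).2 fun x => ?_
    exact habs V W (dist V W) dist_nonneg
      (fun y => (Real.dist_eq _ _).symm.trans_le
        (BoundedContinuousFunction.dist_coe_le_dist y)) x
  refine ⟨hF.fixedPoint, ⟨‖hF.fixedPoint‖, fun x => hF.fixedPoint.norm_coe_le_norm x⟩, fun x => ?_⟩
  exact (DFunLike.congr_fun hF.fixedPoint_isFixedPt x).symm

theorem sum_prod_stdSimplex {ι : Type*} [Fintype ι] [DecidableEq ι] {X : ι → Type*}
    [∀ i, Fintype (X i)] (p : ∀ i, stdSimplex ℝ (X i)) : ∑ x : ∀ i, X i, ∏ i, p i (x i) = 1 := by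
  have h := Finset.prod_univ_sum (fun i => (Finset.univ : Finset (X i))) (fun i x => p i x)
  rw [Fintype.piFinset_univ] at h
  rw [← h]
  exact Finset.prod_eq_one fun i _ => (p i).2.2

theorem stdSimplex_sum_mul_le {X : Type*} [Fintype X] (p : stdSimplex ℝ X) {f : X → ℝ} {c : ℝ}
    (h : ∀ x, f x ≤ c) : ∑ x, p x * f x ≤ c := by
  calc ∑ x, p x * f x ≤ ∑ x, p x * c :=
        Finset.sum_le_sum fun x _ => mul_le_mul_of_nonneg_left (h x) (p.2.1 x)
    _ = c := by
        rw [← Finset.sum_mul, show ∑ x, p x = 1 from p.2.2, one_mul]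

noncomputable section

namespace DecPOMDP

variable {J : ℕ} {S A O Ω : Fin J → Type*} {K : Type*}
  [∀ j, Fintype (S j)] [∀ j, Fintype (A j)] [∀ j, Fintype (O j)] [∀ j, Fintype (Ω j)] [Fintype K]

/-! ### One-step probabilities and Bayes' rule. -/

theorem sum_emitProb (M : DecPOMDP J S A O Ω K) (ω : ∀ j, Ω j) (s : ∀ j, S j) (k : K) :
    ∑ o, ∑ br, ∑ a, M.emitProb ω s k o br a = 1 := by
  have ha : ∀ o, ∑ a, M.jointAct ω o a = 1 := fun o =>
    sum_prod_stdSimplex fun j => (M.opt j (ω j)).act (o j)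
  have hb : ∀ o, ∑ br, M.jointBcast ω o br = 1 := fun o =>
    sum_prod_stdSimplex (X := fun _ => Bool) fun j => (M.opt j (ω j)).bcast (o j)
  simp only [emitProb, ← Finset.mul_sum, ha, hb, mul_one]
  exact (M.obs s k).2.2

theorem obsProb_nonneg (M : DecPOMDP J S A O Ω K) (b : M.Belief) (ω : ∀ j, Ω j)
    (y : ∀ j, Option (O j)) : 0 ≤ M.obsProb b ω y :=
  M.sum_nextWeight b ω y ▸ Finset.sum_nonneg fun x _ => M.nextWeight_nonneg b ω y x.1 x.2

theorem sum_obsProb (M : DecPOMDP J S A O Ω K) (b : M.Belief) (ω : ∀ j, Ω j) :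
    ∑ y, M.obsProb b ω y = 1 := by
  classical
  unfold obsProb
  have hb : ∑ x, b x = 1 := b.2.2
  rw [Fintype.sum_prod_type] at hb
  rw [Finset.sum_comm, ← hb]
  refine Finset.sum_congr rfl fun s _ => ?_
  rw [Finset.sum_comm]
  refine Finset.sum_congr rfl fun k _ => ?_
  refine Eq.trans ?_ (mul_one (b (s, k)))
  rw [Finset.sum_comm, ← M.sum_emitProb ω s k, Finset.mul_sum]
  refine Finset.sum_congr rfl fun o _ => ?_
  rw [Finset.sum_comm, Finset.mul_sum]
  refine Finset.sum_congr rfl fun br _ => ?_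
  rw [Finset.sum_comm, Finset.mul_sum]
  refine Finset.sum_congr rfl fun a _ => ?_
  simp

/-- Bayes' rule without division. It survives zero-probability observations because nonnegative
weights with zero sum all vanish, so the default value in `nextBelief` is harmless. -/
theorem obsProb_mul_nextBelief (M : DecPOMDP J S A O Ω K) (b : M.Belief) (ω : ∀ j, Ω j)
    (y : ∀ j, Option (O j)) (s : ∀ j, S j) (k : K) :
    M.obsProb b ω y * M.nextBelief b ω y (s, k) = M.nextWeight b ω y s k := by
  by_cases h : M.obsProb b ω y = 0
  · rw [h, zero_mul]
    have hs := M.sum_nextWeight b ω y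
    rw [h, Finset.sum_eq_zero_iff_of_nonneg fun x _ => M.nextWeight_nonneg b ω y x.1 x.2] at hs
    exact (hs (s, k) (Finset.mem_univ _)).symm
  · have hn : M.nextBelief b ω y (s, k) = M.nextWeight b ω y s k / M.obsProb b ω y := by
      rw [nextBelief, dif_neg h]
      rfl
    rw [hn, mul_div_cancel₀ _ h]

/-! ### The belief filter and the law of the common information. -/

/-- Probability of the common information `h` under the strategy `ψ` from the belief `b`. -/
def histProb (M : DecPOMDP J S A O Ω K) (ψ : M.Strategy) (b : M.Belief) :
    (t : ℕ) → M.History t → ℝ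
  | 0, _ => 1
  | t + 1, h => histProb M ψ b t (Fin.init h) * ψ t (Fin.init h) (h (Fin.last t)).1 *
      M.obsProb (M.commonBelief b t (Fin.init h)) (h (Fin.last t)).1 (h (Fin.last t)).2

theorem histProb_nonneg (M : DecPOMDP J S A O Ω K) (ψ : M.Strategy) (b : M.Belief) (t : ℕ)
    (h : M.History t) : 0 ≤ M.histProb ψ b t h := by
  induction t with
  | zero => exact zero_le_one
  | succ t ih =>
    exact mul_nonneg (mul_nonneg (ih _) ((ψ t (Fin.init h)).2.1 _)) (M.obsProb_nonneg _ _ _)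

/-- The strategy contributes only a factor depending on the history, and Bayes' rule absorbs the
rest; hence the filter does not involve `ψ`. Summing out state and label then justifies the name
`histProb`. -/
theorem law_eq_histProb_mul (M : DecPOMDP J S A O Ω K) (ψ : M.Strategy) (b : M.Belief) (t : ℕ)
    (h : M.History t) (s : ∀ j, S j) (k : K) :
    M.law ψ b t h s k = M.histProb ψ b t h * M.commonBelief b t h (s, k) := by
  induction t generalizing s k with
  | zero => simp [law, histProb, commonBelief]
  | succ t ih =>
    rw [law, histProb, commonBelief, mul_assoc, obsProb_mul_nextBelief, nextWeight]
    simp only [ih, Finset.mul_sum]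
    refine Finset.sum_congr rfl fun s' _ => Finset.sum_congr rfl fun k' _ => ?_
    ring

theorem sum_law (M : DecPOMDP J S A O Ω K) (ψ : M.Strategy) (b : M.Belief) (t : ℕ)
    (h : M.History t) : ∑ s, ∑ k, M.law ψ b t h s k = M.histProb ψ b t h := by
  simp only [law_eq_histProb_mul, ← Finset.mul_sum]
  have hb : ∑ x, M.commonBelief b t h x = 1 := (M.commonBelief b t h).2.2
  rw [Fintype.sum_prod_type] at hb
  rw [hb, mul_one]

theorem commonBelief_eq_law_div (M : DecPOMDP J S A O Ω K) (ψ : M.Strategy) (b : M.Belief)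
    (t : ℕ) (h : M.History t) (hh : (∑ s, ∑ k, M.law ψ b t h s k) ≠ 0) (s : ∀ j, S j) (k : K) :
    M.commonBelief b t h (s, k) = M.law ψ b t h s k / ∑ s', ∑ k', M.law ψ b t h s' k' := by
  rw [sum_law] at hh ⊢
  rw [law_eq_histProb_mul, mul_div_cancel_left₀ _ hh]

/-! ### Rewards and expectations along the belief process. -/

/-- Expectation of a function of the common belief at stage `t`. -/
def expBelief (M : DecPOMDP J S A O Ω K) (ψ : M.Strategy) (b : M.Belief) (t : ℕ)
    (V : M.Belief → ℝ) : ℝ :=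
  ∑ h : M.History t, M.histProb ψ b t h * V (M.commonBelief b t h)

theorem expBelief_zero (M : DecPOMDP J S A O Ω K) (ψ : M.Strategy) (b : M.Belief)
    (V : M.Belief → ℝ) : M.expBelief ψ b 0 V = V b := by
  simp [expBelief, histProb, commonBelief]

theorem expReward_eq (M : DecPOMDP J S A O Ω K) (ψ : M.Strategy) (b : M.Belief) (t : ℕ) :
    M.expReward ψ b t = ∑ h : M.History t, M.histProb ψ b t h *
      ∑ ω, ψ t h ω * M.optionReward ω (M.commonBelief b t h) := by
  unfold expReward optionReward
  refine Finset.sum_congr rfl fun h _ => ?_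
  simp only [law_eq_histProb_mul, Finset.mul_sum]
  conv_rhs => rw [Finset.sum_comm]
  refine Finset.sum_congr rfl fun s _ => ?_
  conv_rhs => rw [Finset.sum_comm]
  refine Finset.sum_congr rfl fun k _ => Finset.sum_congr rfl fun ω _ => ?_
  ring

/-- Each longer history is a shorter one with a last pair of joint-option and observation appended,
so the sum can be conditioned on the shorter history. -/
theorem expBelief_succ (M : DecPOMDP J S A O Ω K) (ψ : M.Strategy) (b : M.Belief) (t : ℕ)
    (V : M.Belief → ℝ) :
    M.expBelief ψ b (t + 1) V = ∑ h : M.History t, M.histProb ψ b t h *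
      ∑ ω, ψ t h ω * ∑ y, M.obsProb (M.commonBelief b t h) ω y *
        V (M.nextBelief (M.commonBelief b t h) ω y) := by
  unfold expBelief
  rw [← (Fin.snocEquiv fun _ : Fin (t + 1) => (∀ j, Ω j) × (∀ j, Option (O j))).sum_comp,
    Fintype.sum_prod_type, Finset.sum_comm]
  refine Finset.sum_congr rfl fun h _ => ?_
  rw [Fintype.sum_prod_type, Finset.mul_sum]
  refine Finset.sum_congr rfl fun ω _ => ?_
  rw [Finset.mul_sum, Finset.mul_sum]
  refine Finset.sum_congr rfl fun y _ => ?_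
  have hi : Fin.init (Fin.snocEquiv (fun _ : Fin (t + 1) => (∀ j, Ω j) × (∀ j, Option (O j)))
      ((ω, y), h)) = h := Fin.init_snoc (α := fun _ => (∀ j, Ω j) × (∀ j, Option (O j))) _ _
  simp only [histProb, commonBelief, hi, Fin.snocEquiv_apply, Fin.snoc_last]
  ring

/-- The value of the joint-option `ω` at the belief `b` when the continuation value is `V`. -/
def optionValue (M : DecPOMDP J S A O Ω K) (V : M.Belief → ℝ) (b : M.Belief) (ω : ∀ j, Ω j) : ℝ :=
  M.optionReward ω b + M.discount * ∑ y, M.obsProb b ω y * V (M.nextBelief b ω y)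

theorem expReward_add_discount_mul_expBelief (M : DecPOMDP J S A O Ω K) (ψ : M.Strategy)
    (b : M.Belief) (t : ℕ) (V : M.Belief → ℝ) :
    M.expReward ψ b t + M.discount * M.expBelief ψ b (t + 1) V =
      ∑ h : M.History t, M.histProb ψ b t h *
        ∑ ω, ψ t h ω * M.optionValue V (M.commonBelief b t h) ω := by
  rw [expReward_eq, expBelief_succ, Finset.mul_sum, ← Finset.sum_add_distrib]
  refine Finset.sum_congr rfl fun h _ => ?_
  rw [mul_left_comm, ← mul_add, Finset.mul_sum, ← Finset.sum_add_distrib]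
  congr 1
  refine Finset.sum_congr rfl fun ω _ => ?_
  rw [optionValue]
  ring

theorem sum_histProb (M : DecPOMDP J S A O Ω K) (ψ : M.Strategy) (b : M.Belief) (t : ℕ) :
    ∑ h, M.histProb ψ b t h = 1 := by
  induction t with
  | zero => simp [histProb]
  | succ t ih =>
    -- Total mass is the expectation of the constant function 1.
    have h := M.expBelief_succ ψ b t fun _ => 1
    simp only [expBelief, mul_one, sum_obsProb] at h
    rw [h, ← ih]
    refine Finset.sum_congr rfl fun h _ => ?_
    rw [show ∑ ω, ψ t h ω = 1 from (ψ t h).2.2, mul_one]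

theorem abs_sum_histProb_mul_le (M : DecPOMDP J S A O Ω K) (ψ : M.Strategy) (b : M.Belief)
    (t : ℕ) {f : M.History t → ℝ} {C : ℝ} (hf : ∀ h, |f h| ≤ C) :
    |∑ h, M.histProb ψ b t h * f h| ≤ C := by
  calc |∑ h, M.histProb ψ b t h * f h| ≤ ∑ h, |M.histProb ψ b t h * f h| :=
        Finset.abs_sum_le_sum_abs _ _
    _ ≤ ∑ h, M.histProb ψ b t h * C := Finset.sum_le_sum fun h _ => by
        rw [abs_mul, abs_of_nonneg (M.histProb_nonneg ψ b t h)]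
        exact mul_le_mul_of_nonneg_left (hf h) (M.histProb_nonneg ψ b t h)
    _ = C := by rw [← Finset.sum_mul, sum_histProb, one_mul]

theorem abs_sum_stdSimplex_mul_le {X : Type*} [Fintype X] (p : stdSimplex ℝ X) {f : X → ℝ} {C : ℝ}
    (hf : ∀ x, |f x| ≤ C) : |∑ x, p x * f x| ≤ C := by
  refine abs_le.2 ⟨?_, stdSimplex_sum_mul_le p fun x => (abs_le.1 (hf x)).2⟩
  have h := stdSimplex_sum_mul_le p (f := fun x => -f x) (c := C)
    fun x => by linarith [(abs_le.1 (hf x)).1]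
  simp only [mul_neg, Finset.sum_neg_distrib] at h
  linarith

/-! ### Summability and verification of values. -/

theorem exists_abs_optionReward_le (M : DecPOMDP J S A O Ω K) :
    ∃ R, ∀ ω b, |M.optionReward ω b| ≤ R := by
  refine ⟨∑ ω, ∑ x : (∀ j, S j) × K, |M.stateReward ω x.1 x.2|, fun ω b => ?_⟩
  have h : M.optionReward ω b = ∑ x, b x * M.stateReward ω x.1 x.2 := by
    rw [optionReward, Fintype.sum_prod_type]
  rw [h]
  refine abs_sum_stdSimplex_mul_le b fun x => ?_
  refine (Finset.single_le_sum (f := fun x : (∀ j, S j) × K => |M.stateReward ω x.1 x.2|)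
    (fun x _ => abs_nonneg _) (Finset.mem_univ x)).trans ?_
  exact Finset.single_le_sum (f := fun ω => ∑ x : (∀ j, S j) × K, |M.stateReward ω x.1 x.2|)
    (fun ω _ => Finset.sum_nonneg fun x _ => abs_nonneg _) (Finset.mem_univ ω)

theorem summable_discount_pow_mul_expReward (M : DecPOMDP J S A O Ω K) (ψ : M.Strategy)
    (b : M.Belief) : Summable fun t => M.discount ^ t * M.expReward ψ b t := by
  obtain ⟨R, hR⟩ := M.exists_abs_optionReward_le
  have hg := (summable_geometric_of_lt_one M.discount_pos.le M.discount_lt_one).mul_right R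
  refine Summable.of_norm_bounded hg fun t => ?_
  rw [Real.norm_eq_abs, abs_mul, abs_of_nonneg (pow_nonneg M.discount_pos.le t), expReward_eq]
  refine mul_le_mul_of_nonneg_left ?_ (pow_nonneg M.discount_pos.le t)
  exact M.abs_sum_histProb_mul_le ψ b t fun h => abs_sum_stdSimplex_mul_le _ fun ω => hR ω _

theorem tendsto_sum_add_discount_pow_mul_expBelief (M : DecPOMDP J S A O Ω K) (ψ : M.Strategy)
    (b : M.Belief) {V : M.Belief → ℝ} (hV : ∃ C, ∀ b, |V b| ≤ C) :
    Tendsto (fun n => ∑ t ∈ Finset.range n, M.discount ^ t * M.expReward ψ b t +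
      M.discount ^ n * M.expBelief ψ b n V) atTop (𝓝 (M.value ψ b)) := by
  obtain ⟨C, hC⟩ := hV
  have h1 := (M.summable_discount_pow_mul_expReward ψ b).hasSum.tendsto_sum_nat
  have h2 : Tendsto (fun n => M.discount ^ n * M.expBelief ψ b n V) atTop (𝓝 0) := by
    refine squeeze_zero_norm (a := fun n => M.discount ^ n * C) (fun n => ?_) ?_
    · rw [Real.norm_eq_abs, abs_mul, abs_of_nonneg (pow_nonneg M.discount_pos.le n)]
      exact mul_le_mul_of_nonneg_left (M.abs_sum_histProb_mul_le ψ b n fun h => hC _)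
        (pow_nonneg M.discount_pos.le n)
    · simpa using (tendsto_pow_atTop_nhds_zero_of_lt_one M.discount_pos.le
        M.discount_lt_one).mul_const C
  simpa [value] using h1.add h2

/-- Replacing the terminal payoff by one more stage followed by a terminal payoff cannot increase
the total, which starts at `V b`. -/
theorem value_le_of_optionValue_le (M : DecPOMDP J S A O Ω K) {V : M.Belief → ℝ}
    (hV : ∃ C, ∀ b, |V b| ≤ C) (h : ∀ b ω, M.optionValue V b ω ≤ V b) (ψ : M.Strategy)
    (b : M.Belief) : M.value ψ b ≤ V b := by
  refine le_of_tendsto' (M.tendsto_sum_add_discount_pow_mul_expBelief ψ b hV) fun n => ?_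
  induction n with
  | zero => simp [expBelief_zero]
  | succ n ih =>
    refine le_trans ?_ ih
    rw [Finset.sum_range_succ, pow_succ, add_assoc, mul_assoc, ← mul_add,
      expReward_add_discount_mul_expBelief]
    refine add_le_add_right (mul_le_mul_of_nonneg_left (Finset.sum_le_sum fun h' _ =>
      mul_le_mul_of_nonneg_left ?_ (M.histProb_nonneg ψ b n h')) (pow_nonneg M.discount_pos.le n)) _
    exact stdSimplex_sum_mul_le _ fun ω => h _ ω

/-- The same exchange of terminal payoff now preserves the total, so the approximating sequence is
constant. -/
theorem markovValue_eq_of_bellman (M : DecPOMDP J S A O Ω K) {V : M.Belief → ℝ}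
    (hV : ∃ C, ∀ b, |V b| ≤ C) {μ : M.Policy} (h : ∀ b, V b = M.bellman μ V b) (b : M.Belief) :
    M.markovValue (fun _ => μ) b = V b := by
  refine tendsto_nhds_unique (M.tendsto_sum_add_discount_pow_mul_expBelief _ b hV)
    (tendsto_const_nhds.congr fun n => ?_)
  induction n with
  | zero => simp [expBelief_zero]
  | succ n ih =>
    rw [ih, Finset.sum_range_succ, pow_succ, add_assoc, mul_assoc, ← mul_add,
      expReward_add_discount_mul_expBelief]
    congr 2
    exact Finset.sum_congr rfl fun h' _ => congrArg _ (h (M.commonBelief b n h'))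

/-! ### Bounded solutions of the evaluation and optimality equations. -/

theorem optionValue_le_add (M : DecPOMDP J S A O Ω K) {V W : M.Belief → ℝ} {c : ℝ}
    (h : ∀ b, V b ≤ W b + c) (b : M.Belief) (ω : ∀ j, Ω j) :
    M.optionValue V b ω ≤ M.optionValue W b ω + M.discount * c := by
  have h1 : ∑ y, M.obsProb b ω y * V (M.nextBelief b ω y) ≤
      ∑ y, M.obsProb b ω y * W (M.nextBelief b ω y) + c := by
    calc _ ≤ ∑ y, M.obsProb b ω y * (W (M.nextBelief b ω y) + c) :=
          Finset.sum_le_sum fun y _ => mul_le_mul_of_nonneg_left (h _) (M.obsProb_nonneg b ω y)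
      _ = _ := by
          simp only [mul_add, Finset.sum_add_distrib, ← Finset.sum_mul, sum_obsProb, one_mul]
  have h2 := mul_le_mul_of_nonneg_left h1 M.discount_pos.le
  unfold optionValue
  linarith

theorem optionValue_zero (M : DecPOMDP J S A O Ω K) (b : M.Belief) (ω : ∀ j, Ω j) :
    M.optionValue 0 b ω = M.optionReward ω b := by
  simp [optionValue]

theorem exists_bounded_eq_bellman (M : DecPOMDP J S A O Ω K) (μ : M.Policy) :
    ∃ V : M.Belief → ℝ, (∃ C, ∀ b, |V b| ≤ C) ∧ ∀ b, V b = M.bellman μ V b := by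
  obtain ⟨R, hR⟩ := M.exists_abs_optionReward_le
  refine exists_bounded_fixedPoint (M.bellman μ) (R := R) M.discount_pos.le M.discount_lt_one
    (fun V W c _ h b => ?_) fun b => ?_
  · calc M.bellman μ V b ≤ ∑ ω, μ b ω * (M.optionValue W b ω + M.discount * c) :=
          Finset.sum_le_sum fun ω _ =>
            mul_le_mul_of_nonneg_left (M.optionValue_le_add h b ω) ((μ b).2.1 ω)
      _ = M.bellman μ W b + M.discount * c := by
          simp only [mul_add, Finset.sum_add_distrib, ← Finset.sum_mul]
          rw [show ∑ ω, μ b ω = 1 from (μ b).2.2, one_mul]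
          simp only [bellman, optionValue, mul_add, Finset.sum_add_distrib]
  · refine abs_sum_stdSimplex_mul_le (μ b) fun ω => ?_
    exact (congrArg _ (M.optionValue_zero b ω)).trans_le (hR ω b)

theorem bellman_pure (M : DecPOMDP J S A O Ω K) [DecidableEq (∀ j, Ω j)] (V : M.Belief → ℝ)
    (f : M.Belief → ∀ j, Ω j) (b : M.Belief) :
    M.bellman (fun b => ⟨Pi.single (f b) 1, single_mem_stdSimplex ℝ (f b)⟩) V b =
      M.optionValue V b (f b) := by
  refine (Finset.sum_eq_single (f b) (fun ω _ h => ?_) (by simp)).trans ?_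
  · exact mul_eq_zero_of_left (Pi.single_eq_of_ne (M := fun _ => ℝ) h 1) _
  · exact (congrArg (· * _) (Pi.single_eq_same (M := fun _ => ℝ) (f b) 1)).trans (one_mul _)

theorem exists_bounded_solvesDP (M : DecPOMDP J S A O Ω K) [∀ j, Nonempty (Ω j)] :
    ∃ V : M.Belief → ℝ, (∃ C, ∀ b, |V b| ≤ C) ∧ M.SolvesDP V := by
  classical
  obtain ⟨R, hR⟩ := M.exists_abs_optionReward_le
  have hne : (Finset.univ : Finset (∀ j, Ω j)).Nonempty := Finset.univ_nonempty
  -- The maximum is taken over deterministic joint-options; randomising only averages their values,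
  -- so it cannot do better.
  obtain ⟨V, hV, hfix⟩ := exists_bounded_fixedPoint
    (fun V b => Finset.univ.sup' hne (M.optionValue V b)) (R := R) M.discount_pos.le
    M.discount_lt_one
    (fun V W c _ h b => Finset.sup'_le _ _ fun ω hω =>
      (M.optionValue_le_add h b ω).trans (add_le_add_left (Finset.le_sup' _ hω) _))
    (fun b => by
      obtain ⟨ω, -, hω⟩ := Finset.exists_mem_eq_sup' hne (M.optionValue 0 b)
      rw [hω, optionValue_zero]
      exact hR ω b)
  refine ⟨V, hV, fun b => ⟨?_, ?_⟩⟩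
  · obtain ⟨ω, -, hω⟩ := Finset.exists_mem_eq_sup' hne (M.optionValue V b)
    exact ⟨_, (M.bellman_pure V (fun _ => ω) b).trans (hω.symm.trans (hfix b).symm)⟩
  · rintro _ ⟨μ, rfl⟩
    refine stdSimplex_sum_mul_le (μ b) fun ω => ?_
    exact (Finset.le_sup' (M.optionValue V b) (Finset.mem_univ ω)).trans (hfix b).ge

/-! ### Optimality and uniqueness. -/

theorem SolvesDP.value_le {M : DecPOMDP J S A O Ω K} {V : M.Belief → ℝ} (h : M.SolvesDP V)
    (hV : ∃ C, ∀ b, |V b| ≤ C) (ψ : M.Strategy) (b : M.Belief) : M.value ψ b ≤ V b := by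
  classical
  exact M.value_le_of_optionValue_le hV
    (fun b ω => (h b).2 ⟨_, M.bellman_pure V (fun _ => ω) b⟩) ψ b

theorem SolvesDP.exists_markovValue_eq {M : DecPOMDP J S A O Ω K} {V : M.Belief → ℝ}
    (h : M.SolvesDP V) (hV : ∃ C, ∀ b, |V b| ≤ C) :
    ∃ μ : M.Policy, ∀ b, M.markovValue (fun _ => μ) b = V b := by
  -- Each belief yields an entire maximising policy, but the operator at `b` reads it only at `b`,
  -- so the diagonal `μ b b` maximises everywhere.
  choose μ hμ using fun b => (h b).1
  exact ⟨fun b => μ b b, M.markovValue_eq_of_bellman hV fun b => (hμ b).symm⟩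

theorem SolvesDP.isGreatest {M : DecPOMDP J S A O Ω K} {V : M.Belief → ℝ} (h : M.SolvesDP V)
    (hV : ∃ C, ∀ b, |V b| ≤ C) (b : M.Belief) :
    IsGreatest (Set.range fun ψ : M.Strategy => M.value ψ b) (V b) := by
  obtain ⟨μ, hμ⟩ := h.exists_markovValue_eq hV
  refine ⟨⟨_, hμ b⟩, ?_⟩
  rintro _ ⟨ψ, rfl⟩
  exact h.value_le hV ψ b

/-- A bounded solution is an attained maximum over strategies, so the real supremum is genuine and
uniqueness is immediate. -/
theorem SolvesDP.eq_optValue {M : DecPOMDP J S A O Ω K} {V : M.Belief → ℝ} (h : M.SolvesDP V)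
    (hV : ∃ C, ∀ b, |V b| ≤ C) : V = M.optValue :=
  funext fun b => (h.isGreatest hV b).csSup_eq.symm

end DecPOMDP

end

theorem mainTheorem1 {J : ℕ} {S A O Ω : Fin J → Type*} {K : Type*}
    [∀ j, Fintype (S j)] [∀ j, Fintype (A j)] [∀ j, Fintype (O j)] [∀ j, Fintype (Ω j)]
    [∀ j, Nonempty (Ω j)] [Fintype K] (M : DecPOMDP J S A O Ω K) :
    -- the discounted rewards are summable, so all values are well defined
    (∀ (ψ : M.Strategy) (b : M.Belief), Summable fun t => M.discount ^ t * M.expReward ψ b t) ∧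
    -- the common belief is the conditional law given the common information
    (∀ (ψ : M.Strategy) (b : M.Belief) (t : ℕ) (h : M.History t),
      (∑ s, ∑ k, M.law ψ b t h s k) ≠ 0 → ∀ s k,
        M.commonBelief b t h (s, k) = M.law ψ b t h s k / ∑ s', ∑ k', M.law ψ b t h s' k') ∧
    -- (1) the optimal value is the unique bounded solution of the dynamic program
    ((∀ b, IsLUB (Set.range fun ψ : M.Strategy => M.value ψ b) (M.optValue b)) ∧
      (∃ C, ∀ b, |M.optValue b| ≤ C) ∧ M.SolvesDP M.optValue ∧
      ∀ V : M.Belief → ℝ, (∃ C, ∀ b, |V b| ≤ C) → M.SolvesDP V → V = M.optValue) ∧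
    -- (2) the value of a time-homogeneous Markov policy is the unique bounded solution of its
    -- evaluation equation, and such a policy attains the optimal value at every common belief
    (∀ μ : M.Policy,
      (∃ C, ∀ b, |M.markovValue (fun _ => μ) b| ≤ C) ∧
      (∀ b, M.markovValue (fun _ => μ) b = M.bellman μ (M.markovValue fun _ => μ) b) ∧
      ∀ V : M.Belief → ℝ, (∃ C, ∀ b, |V b| ≤ C) → (∀ b, V b = M.bellman μ V b) →
        V = M.markovValue fun _ => μ) ∧
    ∃ μ : M.Policy, ∀ b,
      M.markovValue (fun _ => μ) b = M.optValue b ∧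
      IsGreatest (Set.range fun ν : ℕ → M.Policy => M.markovValue ν b)
        (M.markovValue (fun _ => μ) b) ∧
      IsGreatest (Set.range fun ψ : M.Strategy => M.value ψ b)
        (M.markovValue (fun _ => μ) b) := by
  obtain ⟨V, hV, hDP⟩ := M.exists_bounded_solvesDP
  obtain rfl := hDP.eq_optValue hV
  obtain ⟨μ, hμ⟩ := hDP.exists_markovValue_eq hV
  refine ⟨M.summable_discount_pow_mul_expReward, M.commonBelief_eq_law_div,
    ⟨fun b => (hDP.isGreatest hV b).isLUB, hV, hDP, fun W hW h => h.eq_optValue hW⟩,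
    fun ν => ?_, μ, fun b => ⟨hμ b, ?_, ?_⟩⟩
  · obtain ⟨W, hW, hfix⟩ := M.exists_bounded_eq_bellman ν
    obtain rfl : M.markovValue (fun _ => ν) = W := funext (M.markovValue_eq_of_bellman hW hfix)
    exact ⟨hW, hfix, fun U hU h => (funext (M.markovValue_eq_of_bellman hU h)).symm⟩
  · refine ⟨⟨_, rfl⟩, ?_⟩
    rintro _ ⟨ν, rfl⟩
    -- From a fixed initial belief, a Markov policy is a particular coordination strategy, so the
    -- general bound applies.
    exact (hDP.value_le hV _ b).trans (hμ b).ge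
  · exact (hμ b).symm ▸ hDP.isGreatest hV b
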